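/- Consider $U\ge 1$ identical energy-harvesting sensors sharing a collision channel, in a fixed environmental scenario. **Packets.** Each packet has a utility $V>0$; the sensor sees a noisy observation $Y$ of it, where $Y$ is a random variable with a density whose support is $(0,\infty)$. Decoding requires that the channel SNR $\gamma$ exceed a threshold $\gamma_{\mathrm{th}}(Y)$; the variables $V,Y,\gamma$ may be dependent, and $\mathbb E[\chi(\gamma>\gamma_{\mathrm{th}}(Y))V]<\infty$. Assume that $\bar V(y)=\mathbb E[\chi(\gamma>\gamma_{\mathrm{th}}(Y))V\mid Y=y]$ has a version that is continuous and strictly increasing on $[0,\infty)$ with $\bar V(0)=0$ and $\lim_{y\to\infty}\bar V(y)=\infty$. For $x\in[0,1]$ let $y_{\mathrm{th}}(x)$ be the threshold with $\mathbb P(Y\ge y_{\mathrm{th}}(x))=x$, and let $g(x)=\mathbb E[\chi(Y\ge y_{\mathrm{th}}(x))\,\chi(\gamma>\gamma_{\mathrm{th}}(Y))\,V]$. **Battery.** Let $e_{\max}\ge 1$ and $0<\beta<1$. A policy is a vector $\eta=(\eta(e))_{0\le e\le e_{\max}}$, and the set $\mathcal U$ of admissible policies consists of those with $\eta(0)=0$,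 $\eta(e)\in(0,1)$ for $0<e<e_{\max}$, and $\eta(e_{\max})\in(0,1]$. Under $\eta$ the energy level is the Markov chain $E_{k+1}=\min\{E_k-Q_k+B_k,e_{\max}\}$, where, given $E_k=e$, the variables $Q_k\sim\mathrm{Bernoulli}(\eta(e))$ and $B_k\sim\mathrm{Bernoulli}(\beta)$ are independent; let $\pi_\eta$ be its stationary distribution. Put $$G(\eta)=\sum_{e=1}^{e_{\max}}\pi_\eta(e)\,g(\eta(e)),\qquad P(\eta)=\sum_{e=1}^{e_{\max}}\pi_\eta(e)\,\eta(e).$$ **Equilibrium.** For a profile $(\eta_1,\dots,\eta_U)\in\mathcal U^U$ the network utility is $\sum_{u}G(\eta_u)\prod_{i\ne u}(1-P(\eta_i))$. A policy $\eta^*\in\mathcal U$ is a symmetric Nash equilibrium (SNE) if, when all sensors use $\eta^*$, no change of a single sensor's policy to another policy in $\mathcal U$ increases the network utility; equivalently, $\eta^*$ maximises $G(\eta)-\Lambda(\eta^*)P(\eta)$ over $\eta\in\mathcal U$, where $\Lambda(\eta)=(U-1)\,G(\eta)/(1-P(\eta))$. **Theorem.** If $\eta^*$ is an SNE, then $\eta^*$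 is a strict local maximiser over $\mathcal U$ of the symmetric network utility $U\,G(\eta)\,(1-P(\eta))^{U-1}$: there is $\varepsilon>0$ such that $$U\,G(\eta)\,(1-P(\eta))^{U-1}<U\,G(\eta^*)\,(1-P(\eta^*))^{U-1}$$ for every $\eta\in\mathcal U$ with $\eta\neq\eta^*$ and $\|\eta-\eta^*\|_\infty<\varepsilon$. -/

import Mathlib

namespace EHNetwork

noncomputable section

/-! ### Data packets -/

/-- The statistics of one packet of one sensor: its utility `V`, the sensor's noisy observation `Y`
of that utility, the channel SNR `snr`, and the decoding threshold `snrTh`, which may depend on the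
observation.  The three variables may be correlated. -/
structure PacketModel {Ω : Type*} [MeasurableSpace Ω] (μ : MeasureTheory.Measure Ω) where
  V : Ω → ℝ
  Y : Ω → ℝ
  snr : Ω → ℝ
  snrTh : ℝ → ℝ
  measurable_V : Measurable V
  measurable_Y : Measurable Y
  measurable_snr : Measurable snr
  measurable_snrTh : Measurable snrTh
  V_pos : ∀ᵐ ω ∂μ, 0 < V ω
  /-- `Y` has a density ... -/
  Y_ac : (MeasureTheory.Measure.map Y μ).AbsolutelyContinuous MeasureTheory.volume
  /-- ... whose support is `(0, ∞)`. -/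
  Y_pos : ∀ᵐ ω ∂μ, 0 < Y ω
  Y_supp : ∀ a b : ℝ, 0 ≤ a → a < b → 0 < μ {ω | a < Y ω ∧ Y ω < b}
  /-- The utility that survives channel outage has a finite mean. -/
  integrable_delivered : MeasureTheory.Integrable ({ω | snrTh (Y ω) < snr ω}.indicator V) μ

namespace PacketModel

variable {Ω : Type*} [MeasurableSpace Ω] {μ : MeasureTheory.Measure Ω}

/-- The utility delivered if the packet is sent and no collision occurs: `χ(γ > γ_th(Y)) V`. -/
def delivered (M : PacketModel μ) : Ω → ℝ :=
  {ω | M.snrTh (M.Y ω) < M.snr ω}.indicator M.V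

/-- The function `Vbar` is a version of `y ↦ E[χ(γ > γ_th(Y)) V | Y = y]`. -/
def IsExpectedUtility (M : PacketModel μ) (Vbar : ℝ → ℝ) : Prop :=
  (fun ω => Vbar (M.Y ω)) =ᵐ[μ]
    MeasureTheory.condExp (MeasurableSpace.comap M.Y inferInstance) μ M.delivered

/-- The standing assumption on the expected utility given the observation: it is continuous and
strictly increasing, vanishes at `0`, and tends to infinity. -/
def RegularUtility (M : PacketModel μ) : Prop :=
  ∃ Vbar : ℝ → ℝ, M.IsExpectedUtility Vbar ∧ StrictMonoOn Vbar (Set.Ici 0) ∧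
    ContinuousOn Vbar (Set.Ici 0) ∧ Vbar 0 = 0 ∧ Filter.Tendsto Vbar Filter.atTop Filter.atTop

/-- The censoring threshold that yields the transmission probability `x`, i.e. the `y` with
`P(Y ≥ y) = x`.  It is extended-real, the threshold for `x = 0` being `∞`. -/
def yth (M : PacketModel μ) (x : ℝ) : EReal :=
  sSup {y : EReal | x ≤ μ.real {ω | y ≤ (M.Y ω : EReal)}}

/-- Expected utility reported in one slot, when no collisions occur, by a sensor that transmits the
packets with observation at least `yth x`, hence transmits with probability `x`. -/
def g (M : PacketModel μ) (x : ℝ) : ℝ :=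
  ∫ ω in {ω | M.yth x ≤ (M.Y ω : EReal)}, M.delivered ω ∂μ

end PacketModel

/-! ### Battery -/

variable {emax : ℕ}

/-- Admissible policies: `η e` is the transmission probability at energy level `e`. -/
def admissible (emax : ℕ) : Set (Fin (emax + 1) → ℝ) :=
  {η | η 0 = 0 ∧ η (Fin.last emax) ∈ Set.Ioc (0 : ℝ) 1 ∧
    ∀ e, e ≠ 0 → e ≠ Fin.last emax → η e ∈ Set.Ioo (0 : ℝ) 1}

/-- Battery update `min (e - q + b) emax`, with `q` quanta spent and `b` quanta harvested. -/
def nextLevel (e : Fin (emax + 1)) (q b : ℕ) : Fin (emax + 1) :=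
  ⟨min ((e : ℕ) - q + b) emax, Nat.lt_succ_of_le (min_le_right _ _)⟩

/-- The probability that a Bernoulli variable of mean `x` equals `i`. -/
def bern (x : ℝ) (i : Fin 2) : ℝ := if i = 1 then x else 1 - x

/-- One-slot transition probability of the energy level under `η`: transmission is Bernoulli with
mean `η e`, harvesting is an independent Bernoulli with mean `β`. -/
def trans (β : ℝ) (η : Fin (emax + 1) → ℝ) (e f : Fin (emax + 1)) : ℝ :=
  ∑ q : Fin 2, ∑ b : Fin 2, bern (η e) q * bern β b * (if nextLevel e q b = f then 1 else 0)

/-- `p` is a stationary distribution of the energy level under `η`. -/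
def IsStationary (β : ℝ) (η p : Fin (emax + 1) → ℝ) : Prop :=
  (∀ e, 0 ≤ p e) ∧ ∑ e, p e = 1 ∧ ∀ f, ∑ e, p e * trans β η e f = p f

open Classical in
/-- The steady-state distribution of the energy level under `η`
(`0` if there is no stationary distribution). -/
def steadyState (β : ℝ) (η : Fin (emax + 1) → ℝ) : Fin (emax + 1) → ℝ :=
  if h : ∃ p, IsStationary β η p then h.choose else 0

/-! ### Utility of the network -/

section Utility

variable {Ω : Type*} [MeasurableSpace Ω] {μ : MeasureTheory.Measure Ω}

/-- Average long-term reward of a sensor when all the others are idle. -/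
def G (M : PacketModel μ) (β : ℝ) (η : Fin (emax + 1) → ℝ) : ℝ :=
  ∑ i : Fin emax, steadyState β η i.succ * M.g (η i.succ)

/-- Average long-term transmission probability of a sensor. -/
def P (β : ℝ) (η : Fin (emax + 1) → ℝ) : ℝ :=
  ∑ i : Fin emax, steadyState β η i.succ * η i.succ

/-- Network utility of the policy profile `ηs`. -/
def networkUtility {U : ℕ} (M : PacketModel μ) (β : ℝ) (ηs : Fin U → Fin (emax + 1) → ℝ) : ℝ :=
  ∑ u, G M β (ηs u) * ∏ i ∈ Finset.univ.erase u, (1 - P β (ηs i))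

/-- Nash equilibrium of the game in which every sensor maximizes the common network utility over
its own admissible policies. -/
def IsNash {U : ℕ} (M : PacketModel μ) (β : ℝ) (ηs : Fin U → Fin (emax + 1) → ℝ) : Prop :=
  (∀ u, ηs u ∈ admissible emax) ∧ ∀ u, ∀ η ∈ admissible emax,
    networkUtility M β (Function.update ηs u η) ≤ networkUtility M β ηs

/-- Symmetric Nash equilibrium: all `U` sensors using `η` is a Nash equilibrium. -/
def IsSNE (U : ℕ) (M : PacketModel μ) (β : ℝ) (η : Fin (emax + 1) → ℝ) : Prop :=
  IsNash M β (fun _ : Fin U => η)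

/-- The Lagrange multiplier `Λ(η) = (U - 1) G(η) / (1 - P(η))`. -/
def Lam (U : ℕ) (M : PacketModel μ) (β : ℝ) (η : Fin (emax + 1) → ℝ) : ℝ :=
  ((U : ℝ) - 1) * (G M β η / (1 - P β η))

/-- Network utility when all `U` sensors use the policy `η`. -/
def symUtility (U : ℕ) (M : PacketModel μ) (β : ℝ) (η : Fin (emax + 1) → ℝ) : ℝ :=
  U * G M β η * (1 - P β η) ^ (U - 1)

end Utility

/-! ### The steady state is well defined -/

theorem sum_trans_lt (β : ℝ) (η : Fin (emax + 1) → ℝ) (k : ℕ) (e : Fin (emax + 1)) :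
    ∑ f : Fin (emax + 1), (if (f : ℕ) < k then trans β η e f else 0) =
      ∑ q : Fin 2, ∑ b : Fin 2, bern (η e) q * bern β b *
        (if min ((e : ℕ) - q + b) emax < k then 1 else 0) := by
  have h : ∀ f : Fin (emax + 1), (if (f : ℕ) < k then trans β η e f else 0) =
      ∑ q : Fin 2, ∑ b : Fin 2, bern (η e) q * bern β b *
        (if nextLevel e q b = f then (if (f : ℕ) < k then 1 else 0) else 0) := by
    intro f
    by_cases hf : (f : ℕ) < k <;> simp [hf, trans]
  simp only [h]
  rw [Finset.sum_comm]
  refine Finset.sum_congr rfl fun q _ => ?_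
  rw [Finset.sum_comm]
  refine Finset.sum_congr rfl fun b _ => ?_
  rw [← Finset.mul_sum, Finset.sum_ite_eq]
  simp [nextLevel]

/-- The flow through the cut between two consecutive levels. -/
theorem cut_flow (β : ℝ) (η p : Fin (emax + 1) → ℝ) (h0 : η 0 = 0) (i : Fin emax) :
    ∑ e, p e * ∑ f : Fin (emax + 1), (if (f : ℕ) < (i : ℕ) + 1 then trans β η e f else 0) =
      ∑ e : Fin (emax + 1), (if (e : ℕ) < (i : ℕ) + 1 then p e else 0)
        - p i.castSucc * (β * (1 - η i.castSucc)) + p i.succ * ((1 - β) * η i.succ) := by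
  have key : ∀ e : Fin (emax + 1),
      p e * ∑ f : Fin (emax + 1), (if (f : ℕ) < (i : ℕ) + 1 then trans β η e f else 0) =
      (if (e : ℕ) < (i : ℕ) + 1 then p e else 0)
        - (if e = i.castSucc then p e * (β * (1 - η e)) else 0)
        + (if e = i.succ then p e * ((1 - β) * η e) else 0) := by
    intro e
    rw [sum_trans_lt]
    have hi := i.isLt
    have he := e.isLt
    simp only [Fin.sum_univ_two, Fin.ext_iff, Fin.val_castSucc, Fin.val_succ, bern,
      Fin.val_zero, Fin.val_one, zero_ne_one, if_true, if_false]
    by_cases hz : (e : ℕ) = 0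
    · have hz' : η e = 0 := by rw [show e = 0 from Fin.ext hz, h0]
      simp only [hz', hz]
      split_ifs <;> first | (exfalso; omega) | ring
    · split_ifs <;> first | (exfalso; omega) | ring
  simp only [key, Finset.sum_add_distrib, Finset.sum_sub_distrib, Finset.sum_ite_eq',
    Finset.mem_univ, if_true]

theorem sum_trans (β : ℝ) (η : Fin (emax + 1) → ℝ) (e : Fin (emax + 1)) :
    ∑ f : Fin (emax + 1), trans β η e f = 1 := by
  have h := sum_trans_lt β η (emax + 1) e
  have h1 : ∀ f : Fin (emax + 1), (f : ℕ) < emax + 1 := fun f => f.isLt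
  have h2 : ∀ a : ℕ, min a emax < emax + 1 := fun a => by omega
  simp only [h1, h2, if_true] at h
  rw [h]
  simp only [Fin.sum_univ_two, bern, zero_ne_one, if_true, if_false]
  ring

/-- Balance across every cut is the same as stationarity. -/
theorem stationary_iff_balance (β : ℝ) (η p : Fin (emax + 1) → ℝ) (h0 : η 0 = 0) :
    (∀ f, ∑ e, p e * trans β η e f = p f) ↔
      ∀ i : Fin emax, p i.castSucc * (β * (1 - η i.castSucc)) =
        p i.succ * ((1 - β) * η i.succ) := by
  have swap : ∀ k : ℕ,
      ∑ e, p e * ∑ f : Fin (emax + 1), (if (f : ℕ) < k then trans β η e f else 0) =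
      ∑ f : Fin (emax + 1), (if (f : ℕ) < k then ∑ e, p e * trans β η e f else 0) := by
    intro k
    simp only [Finset.mul_sum]
    rw [Finset.sum_comm]
    refine Finset.sum_congr rfl fun f _ => ?_
    by_cases hf : (f : ℕ) < k <;> simp [hf]
  constructor
  · intro h i
    have h1 := cut_flow β η p h0 i
    rw [swap] at h1
    simp only [h] at h1
    linarith
  · intro h
    have H : ∀ k : ℕ, k ≤ emax + 1 →
        ∑ f : Fin (emax + 1), (if (f : ℕ) < k then (∑ e, p e * trans β η e f - p f) else 0)
          = 0 := by
      intro k hk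
      have e1 : ∀ f : Fin (emax + 1),
          (if (f : ℕ) < k then (∑ e, p e * trans β η e f - p f) else 0) =
          (if (f : ℕ) < k then (∑ e, p e * trans β η e f) else 0) -
            (if (f : ℕ) < k then p f else 0) := by
        intro f
        split_ifs <;> simp
      simp only [e1, Finset.sum_sub_distrib]
      rw [← swap]
      rcases Nat.eq_zero_or_pos k with rfl | hpos
      · simp
      · rcases Nat.lt_or_ge k (emax + 1) with hlt | hge
        · have h1 := cut_flow β η p h0 ⟨k - 1, by omega⟩
          have h2 := h ⟨k - 1, by omega⟩
          simp only [Nat.sub_add_cancel hpos] at h1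
          linarith
        · have hk' : k = emax + 1 := le_antisymm hk hge
          subst hk'
          have h3 : ∀ f : Fin (emax + 1), (f : ℕ) < emax + 1 := fun f => f.isLt
          simp [h3, sum_trans]
    intro f
    have h1 := H f (by omega)
    have h2 := H (f + 1) (by omega)
    have h3 : ∀ f' : Fin (emax + 1),
        (if (f' : ℕ) < (f : ℕ) + 1 then (∑ e, p e * trans β η e f' - p f') else 0) =
        (if (f' : ℕ) < (f : ℕ) then (∑ e, p e * trans β η e f' - p f') else 0) +
        (if f' = f then (∑ e, p e * trans β η e f' - p f') else 0) := by
      intro f'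
      simp only [Fin.ext_iff]
      split_ifs <;> first | (exfalso; omega) | ring
    simp only [h3, Finset.sum_add_distrib, Finset.sum_ite_eq', Finset.mem_univ, if_true] at h2
    linarith

theorem admissible_pos {η : Fin (emax + 1) → ℝ} (hη : η ∈ admissible emax) (i : Fin emax) :
    0 < η i.succ := by
  obtain ⟨_, h1, h2⟩ := hη
  by_cases h : i.succ = Fin.last emax
  · rw [h]; exact h1.1
  · exact (h2 _ (Fin.succ_ne_zero i) h).1

theorem admissible_lt_one {η : Fin (emax + 1) → ℝ} (hη : η ∈ admissible emax) (i : Fin emax) :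
    η i.castSucc < 1 := by
  obtain ⟨h0, _, h2⟩ := hη
  by_cases h : i.castSucc = 0
  · rw [h, h0]; exact one_pos
  · exact (h2 _ h (Fin.castSucc_lt_last i).ne).2

/-- Unnormalized steady state. -/
def weight (β : ℝ) (η : Fin (emax + 1) → ℝ) (e : Fin (emax + 1)) : ℝ :=
  Fin.induction (motive := fun _ => ℝ) 1
    (fun i w => w * (β * (1 - η i.castSucc)) / ((1 - β) * η i.succ)) e

theorem weight_pos {β : ℝ} (hβ : β ∈ Set.Ioo (0 : ℝ) 1) {η : Fin (emax + 1) → ℝ}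
    (hη : η ∈ admissible emax) (e : Fin (emax + 1)) : 0 < weight β η e := by
  induction e using Fin.induction with
  | zero => simp [weight]
  | succ i ih =>
    have h1 := admissible_pos hη i
    have h2 := admissible_lt_one hη i
    have h3 : 0 < 1 - β := by linarith [hβ.2]
    have h4 : 0 < 1 - η i.castSucc := by linarith
    have h5 := hβ.1
    have h6 : weight β η i.succ =
        weight β η i.castSucc * (β * (1 - η i.castSucc)) / ((1 - β) * η i.succ) := by
      simp [weight]
    rw [h6]
    positivity

theorem balance_iff_weight {β : ℝ} (hβ : β ∈ Set.Ioo (0 : ℝ) 1) {η : Fin (emax + 1) → ℝ}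
    (hη : η ∈ admissible emax) (p : Fin (emax + 1) → ℝ) :
    (∀ i : Fin emax, p i.castSucc * (β * (1 - η i.castSucc)) =
        p i.succ * ((1 - β) * η i.succ)) ↔ ∀ e, p e = p 0 * weight β η e := by
  have h6 : ∀ i : Fin emax, weight β η i.succ =
      weight β η i.castSucc * (β * (1 - η i.castSucc)) / ((1 - β) * η i.succ) := by
    intro i; simp [weight]
  have h7 : ∀ i : Fin emax, (1 - β) * η i.succ ≠ 0 := fun i =>
    (mul_pos (by linarith [hβ.2]) (admissible_pos hη i)).ne'
  constructor
  · intro h e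
    induction e using Fin.induction with
    | zero => simp [weight]
    | succ i ih =>
      rw [h6, ← mul_div_assoc, eq_div_iff (h7 i), ← h i, ih]
      ring
  · intro h i
    rw [h i.castSucc, h i.succ, h6, ← mul_div_assoc, div_mul_cancel₀ _ (h7 i)]
    ring

/-- Under an admissible policy the energy level has exactly one stationary distribution, given by
the product formula. -/
theorem isStationary_iff {β : ℝ} (hβ : β ∈ Set.Ioo (0 : ℝ) 1) {η : Fin (emax + 1) → ℝ}
    (hη : η ∈ admissible emax) (p : Fin (emax + 1) → ℝ) :
    IsStationary β η p ↔ p = fun e => weight β η e / ∑ f, weight β η f := by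
  have hpos : 0 < ∑ f, weight β η f :=
    Finset.sum_pos (fun f _ => weight_pos hβ hη f) ⟨0, Finset.mem_univ _⟩
  unfold IsStationary
  rw [stationary_iff_balance β η p hη.1, balance_iff_weight hβ hη]
  constructor
  · rintro ⟨_, h1, h2⟩
    have h3 : p 0 * ∑ f, weight β η f = 1 := by
      rw [Finset.mul_sum, ← h1]
      exact Finset.sum_congr rfl fun e _ => (h2 e).symm
    funext e
    rw [h2 e, eq_div_iff hpos.ne', mul_right_comm, h3, one_mul]
  · rintro rfl
    refine ⟨fun e => (div_pos (weight_pos hβ hη e) hpos).le, ?_, fun e => ?_⟩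
    · rw [← Finset.sum_div, div_self hpos.ne']
    · have : weight β η 0 = 1 := by simp [weight]
      simp only [this]
      ring

theorem steadyState_eq {β : ℝ} (hβ : β ∈ Set.Ioo (0 : ℝ) 1) {η : Fin (emax + 1) → ℝ}
    (hη : η ∈ admissible emax) :
    steadyState β η = fun e => weight β η e / ∑ f, weight β η f := by
  have h : ∃ p, IsStationary β η p := ⟨_, (isStationary_iff hβ hη _).2 rfl⟩
  rw [steadyState, dif_pos h]
  exact (isStationary_iff hβ hη _).1 h.choose_spec

theorem steadyState_pos {β : ℝ} (hβ : β ∈ Set.Ioo (0 : ℝ) 1) {η : Fin (emax + 1) → ℝ}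
    (hη : η ∈ admissible emax) (e : Fin (emax + 1)) : 0 < steadyState β η e := by
  rw [steadyState_eq hβ hη]
  exact div_pos (weight_pos hβ hη e)
    (Finset.sum_pos (fun f _ => weight_pos hβ hη f) ⟨0, Finset.mem_univ _⟩)

theorem steadyState_isStationary {β : ℝ} (hβ : β ∈ Set.Ioo (0 : ℝ) 1) {η : Fin (emax + 1) → ℝ}
    (hη : η ∈ admissible emax) : IsStationary β η (steadyState β η) :=
  (isStationary_iff hβ hη _).2 (steadyState_eq hβ hη)

theorem P_lt_one {β : ℝ} (hβ : β ∈ Set.Ioo (0 : ℝ) 1) {η : Fin (emax + 1) → ℝ}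
    (hη : η ∈ admissible emax) : P β η < 1 := by
  have h1 := (steadyState_isStationary hβ hη).2.1
  rw [Fin.sum_univ_succ] at h1
  have h2 := steadyState_pos hβ hη 0
  have h3 : P β η ≤ ∑ i : Fin emax, steadyState β η i.succ := by
    refine Finset.sum_le_sum fun i _ => ?_
    have h4 : η i.succ ≤ 1 := by
      by_cases h : i.succ = Fin.last emax
      · rw [h]; exact hη.2.1.2
      · exact (hη.2.2 _ (Fin.succ_ne_zero i) h).2.le
    nlinarith [steadyState_pos hβ hη i.succ]
  linarith

/-! ### The equilibrium as a fixed point -/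

/-- Utility when one of `U` sensors uses `η` and all the others use `ηstar`. -/
theorem networkUtility_update {Ω : Type*} [MeasurableSpace Ω] {μ : MeasureTheory.Measure Ω}
    {U : ℕ} (M : PacketModel μ) {β : ℝ} {ηstar η : Fin (emax + 1) → ℝ}
    (hP : P β ηstar < 1) (u : Fin U) :
    networkUtility M β (Function.update (fun _ : Fin U => ηstar) u η) =
      (1 - P β ηstar) ^ (U - 1) *
        (G M β η - Lam U M β ηstar * P β η + Lam U M β ηstar) := by
  have hpos : (1 - P β ηstar) ≠ 0 := by linarith
  obtain ⟨n, rfl⟩ : ∃ n, U = n + 1 := ⟨U - 1, by have := u.isLt; omega⟩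
  set q := 1 - P β ηstar with hq
  have hu : ∏ i ∈ Finset.univ.erase u,
      (1 - P β (Function.update (fun _ : Fin (n + 1) => ηstar) u η i)) = q ^ n := by
    rw [Finset.prod_congr rfl (g := fun _ => q), Finset.prod_const,
      Finset.card_erase_of_mem (Finset.mem_univ u)]
    · simp
    · intro i hi
      rw [Function.update_of_ne (Finset.ne_of_mem_erase hi)]
  have hv : ∀ v ∈ Finset.univ.erase u,
      G M β (Function.update (fun _ : Fin (n + 1) => ηstar) u η v) *
        ∏ i ∈ Finset.univ.erase v,
          (1 - P β (Function.update (fun _ : Fin (n + 1) => ηstar) u η i)) =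
      G M β ηstar * ((1 - P β η) * (q ^ n / q)) := by
    intro v hv
    have hvu := Finset.ne_of_mem_erase hv
    have hmem : u ∈ Finset.univ.erase v := Finset.mem_erase.2 ⟨hvu.symm, Finset.mem_univ _⟩
    rw [Function.update_of_ne hvu, ← Finset.mul_prod_erase _ _ hmem, Function.update_self]
    congr 2
    rw [Finset.prod_congr rfl (g := fun _ => q), Finset.prod_const,
      Finset.card_erase_of_mem hmem, Finset.card_erase_of_mem (Finset.mem_univ v),
      Finset.card_univ, Fintype.card_fin, eq_div_iff hpos, ← pow_succ]
    · congr 1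
      have := Fin.val_ne_of_ne hvu
      omega
    · intro i hi
      rw [Function.update_of_ne (Finset.ne_of_mem_erase hi)]
  unfold networkUtility
  rw [← Finset.add_sum_erase _ _ (Finset.mem_univ u), hu, Finset.sum_congr rfl hv,
    Finset.sum_const, Finset.card_erase_of_mem (Finset.mem_univ u), Function.update_self,
    Finset.card_univ, Fintype.card_fin, Lam, ← hq]
  simp only [Nat.add_sub_cancel, nsmul_eq_mul, Nat.cast_add, Nat.cast_one]
  field_simp
  ring

/-- A policy is a symmetric Nash equilibrium iff it maximizes `G(η) - Λ(ηstar) P(η)`. -/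
theorem isSNE_iff {Ω : Type*} [MeasurableSpace Ω] {μ : MeasureTheory.Measure Ω}
    {U : ℕ} (hU : 1 ≤ U) (M : PacketModel μ) {β : ℝ} (hβ : β ∈ Set.Ioo (0 : ℝ) 1)
    (ηstar : Fin (emax + 1) → ℝ) :
    IsSNE U M β ηstar ↔ ηstar ∈ admissible emax ∧ ∀ η ∈ admissible emax,
      G M β η - Lam U M β ηstar * P β η ≤ G M β ηstar - Lam U M β ηstar * P β ηstar := by
  have key : ∀ (u : Fin U), ηstar ∈ admissible emax → ∀ η ∈ admissible emax,
      (networkUtility M β (Function.update (fun _ : Fin U => ηstar) u η) ≤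
        networkUtility M β (fun _ : Fin U => ηstar) ↔
      G M β η - Lam U M β ηstar * P β η ≤ G M β ηstar - Lam U M β ηstar * P β ηstar) := by
    intro u hs η hη
    have hP := P_lt_one hβ hs
    have h1 := networkUtility_update M (η := η) hP u
    have h2 := networkUtility_update M (η := ηstar) hP u
    have h3 : Function.update (fun _ : Fin U => ηstar) u ηstar = fun _ => ηstar :=
      Function.update_eq_self u _
    rw [h3] at h2
    have h4 : 0 < (1 - P β ηstar) ^ (U - 1) := pow_pos (by linarith) _
    rw [h1, h2, mul_le_mul_iff_right₀ h4, add_le_add_iff_right]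
  constructor
  · rintro ⟨h1, h2⟩
    have hs := h1 ⟨0, hU⟩
    exact ⟨hs, fun η hη => (key ⟨0, hU⟩ hs η hη).1 (h2 _ η hη)⟩
  · rintro ⟨hs, h⟩
    exact ⟨fun _ => hs, fun u η hη => (key u hs η hη).2 (h η hη)⟩

end

end EHNetwork

/-! The natural coordinates are the occupation measures `e ↦ (π(e), π(e) η(e))` rather than the
policies. The balance equations are linear in this pair, so the average of two admissible occupation
measures again comes from an admissible policy, `midPolicy`. In these coordinates `P` is linear,
while `G` is a sum of perspectives `π(e) g(π(e)η(e) / π(e))` and inherits strict concavity from `g`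
(`exists_strict_supergradient`, `G_add_lt_midPolicy`). Hence for any multiplier `L` the Lagrangian
`G - L * P` has at most one maximizer (`lagrangian_lt_of_isMax`).

An SNE `η*` maximizes the Lagrangian at `L = Λ(η*)`, so any other `η` satisfies `G(η) < G(η*) +
Λ(η*) (P(η) - P(η*)) = G(η*) (1 + n t)`, where `n = U - 1` and `t = (P(η) - P(η*)) / (1 - P(η*))`.
Since `1 - P(η) = (1 - P(η*)) (1 - t)`, the inequality `(1 + n t) (1 - t)^n ≤ 1` finishes the
comparison. Nothing here is local: the SNE is a strict global maximizer. -/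

namespace EHNetwork

open MeasureTheory Set Filter Topology ProbabilityTheory

/-! ### Censoring thresholds and strict concavity of the reward `g`. -/

section Packets

variable {Ω : Type*} [MeasurableSpace Ω] {μ : Measure Ω}

/-- Every transmission probability in `(0, 1]` is attained by a real censoring threshold. -/
theorem PacketModel.exists_threshold [IsProbabilityMeasure μ] (M : PacketModel μ) {x : ℝ}
    (hx : x ∈ Ioc (0 : ℝ) 1) :
    ∃ θ : ℝ, 0 ≤ θ ∧ μ.real {ω | θ ≤ M.Y ω} = x ∧ M.yth x = θ := by
  set ν := Measure.map M.Y μ with hν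
  have : IsProbabilityMeasure ν := Measure.isProbabilityMeasure_map M.measurable_Y.aemeasurable
  have hsing : ∀ y, ν {y} = 0 := fun y => M.Y_ac (by simp)
  -- The jump of the cdf at a point is the mass of that point, which is zero by absolute continuity.
  have hcont : Continuous (cdf ν) := by
    rw [continuous_iff_continuousAt]
    intro a
    have h2 := (cdf ν).measure_singleton a
    rw [measure_cdf, hsing] at h2
    have h3 : cdf ν a ≤ Function.leftLim (cdf ν) a := by
      have := ENNReal.ofReal_eq_zero.1 h2.symm
      linarith
    rw [(cdf ν).mono.continuousAt_iff_leftLim_eq_rightLim, StieltjesFunction.rightLim_eq]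
    exact le_antisymm ((cdf ν).mono.leftLim_le le_rfl) h3
  have hF : ∀ y : ℝ, μ.real {ω | y ≤ M.Y ω} = 1 - cdf ν y := by
    intro y
    have h1 : ν.real (Ici y) = μ.real {ω | y ≤ M.Y ω} :=
      map_measureReal_apply M.measurable_Y measurableSet_Ici
    have h2 : ν.real (Iio y) = cdf ν y := by
      rw [cdf_eq_real]
      have : NullSingletonClass ν := ⟨hsing⟩
      exact measureReal_congr Iio_ae_eq_Iic
    rw [← h1, ← h2, ← compl_Iio, probReal_compl_eq_one_sub measurableSet_Iio]
  have h0 : cdf ν 0 = 0 := by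
    have h1 : μ.real {ω | (0 : ℝ) ≤ M.Y ω} = 1 := by
      have h2 : ({ω | (0 : ℝ) ≤ M.Y ω} : Set Ω) =ᵐ[μ] univ :=
        eventuallyEq_univ.2 (M.Y_pos.mono fun ω h => h.le)
      rw [measureReal_congr h2, probReal_univ]
    have := hF 0
    linarith
  obtain ⟨b, hb⟩ : ∃ b : ℝ, 0 < b ∧ 1 - x < cdf ν b :=
    ((eventually_gt_atTop 0).and
      ((tendsto_cdf_atTop ν).eventually (lt_mem_nhds (by linarith [hx.1])))).exists
  obtain ⟨θ, hθ, hθx⟩ := intermediate_value_Icc hb.1.le hcont.continuousOn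
    (show 1 - x ∈ Icc (cdf ν 0) (cdf ν b) from ⟨by rw [h0]; linarith [hx.2], hb.2.le⟩)
  have hθF : μ.real {ω | θ ≤ M.Y ω} = x := by rw [hF, hθx]; ring
  refine ⟨θ, hθ.1, hθF, ?_⟩
  refine IsGreatest.csSup_eq ⟨?_, ?_⟩
  · simp only [mem_ofPred_eq, EReal.coe_le_coe_iff, hθF, le_refl]
  · intro y hy
    by_contra! hlt
    have hy : x ≤ μ.real {ω | y ≤ (M.Y ω : EReal)} := hy
    induction y with
    | bot => exact not_lt_bot hlt
    | top =>
      simp only [top_le_iff, EReal.coe_ne_top, ofPred_false, measureReal_empty] at hy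
      linarith [hx.1]
    | coe y =>
      simp only [EReal.coe_le_coe_iff] at hy
      have hlt : θ < y := by exact_mod_cast hlt
      -- Full support gives the gap `(θ, y)` positive mass, so raising the threshold above `θ` drops
      -- the transmission probability strictly below `x`.
      have h1 := M.Y_supp θ y hθ.1 hlt
      have h2 : μ.real ({ω | θ < M.Y ω ∧ M.Y ω < y} ∪ {ω | y ≤ M.Y ω}) ≤ x := by
        rw [← hθF]
        refine measureReal_mono ?_
        rintro ω (h | h)
        · exact h.1.le
        · exact hlt.le.trans h
      rw [measureReal_union _ (measurableSet_le measurable_const M.measurable_Y)] at h2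
      · have h3 : 0 < μ.real {ω | θ < M.Y ω ∧ M.Y ω < y} :=
          ENNReal.toReal_pos h1.ne' (measure_ne_top _ _)
        linarith
      · exact disjoint_left.2 fun ω h h' => absurd h.2 (not_lt.2 h')

/-- The event `θ ≤ Y` is `Y`-measurable, so the delivered utility may be replaced by its conditional
expectation given `Y`. -/
theorem PacketModel.g_eq_setIntegral [IsProbabilityMeasure μ] (M : PacketModel μ) {Vbar : ℝ → ℝ}
    (hV : M.IsExpectedUtility Vbar) {x θ : ℝ} (hθ : M.yth x = θ) :
    M.g x = ∫ ω in {ω | θ ≤ M.Y ω}, Vbar (M.Y ω) ∂μ := by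
  have hm : MeasurableSpace.comap M.Y inferInstance ≤ (inferInstance : MeasurableSpace Ω) :=
    M.measurable_Y.comap_le
  rw [PacketModel.g, hθ]
  simp only [EReal.coe_le_coe_iff]
  refine (setIntegral_condExp hm M.integrable_delivered
    (s := {ω | θ ≤ M.Y ω}) ⟨Ici θ, measurableSet_Ici, rfl⟩).symm.trans ?_
  exact setIntegral_congr_ae (M.measurable_Y measurableSet_Ici)
    (hV.mono fun ω h _ => h.symm)

/-- The reward function lies strictly below a line touching it at `z`. -/
theorem PacketModel.exists_strict_supergradient [IsProbabilityMeasure μ] (M : PacketModel μ)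
    (hM : M.RegularUtility) {z : ℝ} (hz : z ∈ Ioc (0 : ℝ) 1) :
    ∃ c, ∀ x ∈ Ioc (0 : ℝ) 1, x ≠ z → M.g x < M.g z + c * (x - z) := by
  obtain ⟨Vbar, hV, hmono, -, -, -⟩ := hM
  obtain ⟨θ, hθ0, hθF, hθ⟩ := M.exists_threshold hz
  -- The slope is the marginal value of transmitting: the expected utility of a packet exactly at
  -- the threshold for `z`.
  refine ⟨Vbar θ, fun x hx hxz => ?_⟩
  obtain ⟨τ, hτ0, hτF, hτ⟩ := M.exists_threshold hx
  have hne : τ ≠ θ := by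
    rintro rfl
    exact hxz (hτF.symm.trans hθF)
  set c := Vbar θ
  have hint : Integrable (fun ω => Vbar (M.Y ω)) μ := integrable_condExp.congr hV.symm
  have hint' : Integrable (fun ω => Vbar (M.Y ω) - c) μ := hint.sub (integrable_const c)
  have hmeas : ∀ a : ℝ, MeasurableSet {ω | a ≤ M.Y ω} := fun a =>
    M.measurable_Y measurableSet_Ici
  have hsub : ∀ a : ℝ, ∫ ω, {ω | a ≤ M.Y ω}.indicator (fun ω => Vbar (M.Y ω) - c) ω ∂μ =
      ∫ ω in {ω | a ≤ M.Y ω}, Vbar (M.Y ω) ∂μ - μ.real {ω | a ≤ M.Y ω} * c := by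
    intro a
    rw [integral_indicator (hmeas a), integral_sub hint.integrableOn (integrable_const c),
      setIntegral_const, smul_eq_mul]
  -- This integral equals `g z - g x - c * (z - x)`. By monotonicity of `Vbar`, accepting exactly
  -- the packets with `Vbar(Y) ≥ c` is pointwise optimal for the net value `Vbar(Y) - c`. The loss
  -- is strict when `Y` lies strictly between the two thresholds, an event of positive probability.
  have hpos : 0 < ∫ ω, ({ω | θ ≤ M.Y ω}.indicator (fun ω => Vbar (M.Y ω) - c) ω -
      {ω | τ ≤ M.Y ω}.indicator (fun ω => Vbar (M.Y ω) - c) ω) ∂μ := by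
    rw [integral_pos_iff_support_of_nonneg_ae]
    · rcases lt_or_gt_of_ne hne with h | h
      · refine (M.Y_supp τ θ hτ0 h).trans_le (measure_mono ?_)
        rintro ω ⟨h1, h2⟩
        have h3 : Vbar (M.Y ω) < c := hmono (hτ0.trans h1.le) hθ0 h2
        simp only [Function.mem_support, indicator, mem_ofPred_eq, if_neg (not_le.2 h2),
          if_pos h1.le]
        linarith
      · refine (M.Y_supp θ τ hθ0 h).trans_le (measure_mono ?_)
        rintro ω ⟨h1, h2⟩
        have h3 : c < Vbar (M.Y ω) := hmono hθ0 (hθ0.trans h1.le) h1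
        simp only [Function.mem_support, indicator, mem_ofPred_eq, if_neg (not_le.2 h2),
          if_pos h1.le]
        linarith
    · filter_upwards [M.Y_pos] with ω hω
      have h1 : θ ≤ M.Y ω → c ≤ Vbar (M.Y ω) := fun h => hmono.monotoneOn hθ0 hω.le h
      have h2 : M.Y ω < θ → Vbar (M.Y ω) ≤ c := fun h => hmono.monotoneOn hω.le hθ0 h.le
      simp only [indicator, mem_ofPred_eq, Pi.zero_apply]
      split_ifs with h3 h4 h4
      · linarith
      · linarith [h1 h3]
      · linarith [h2 (not_le.1 h3)]
      · linarith
    · exact (hint'.indicator (hmeas θ)).sub (hint'.indicator (hmeas τ))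
  rw [integral_sub (hint'.indicator (hmeas θ)) (hint'.indicator (hmeas τ)), hsub, hsub, hθF, hτF,
    ← M.g_eq_setIntegral hV hθ, ← M.g_eq_setIntegral hV hτ] at hpos
  linarith

theorem PacketModel.g_nonneg (M : PacketModel μ) (x : ℝ) : 0 ≤ M.g x := by
  refine integral_nonneg_of_ae (ae_restrict_of_ae (M.V_pos.mono fun ω h => ?_))
  exact indicator_apply_nonneg fun _ => h.le

end Packets

/-! ### Averaging of occupation measures and uniqueness of the Lagrangian maximizer. -/

section Battery

variable {emax : ℕ}

theorem admissible_le_one {η : Fin (emax + 1) → ℝ} (hη : η ∈ admissible emax) (i : Fin emax) :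
    η i.succ ≤ 1 := by
  by_cases h : i.succ = Fin.last emax
  · rw [h]; exact hη.2.1.2
  · exact (hη.2.2 _ (Fin.succ_ne_zero i) h).2.le

/-- The policy whose occupation measure is the mean of those of two given policies. -/
noncomputable def midPolicy (β : ℝ) (η ζ : Fin (emax + 1) → ℝ) (e : Fin (emax + 1)) : ℝ :=
  (steadyState β η e * η e + steadyState β ζ e * ζ e) / (steadyState β η e + steadyState β ζ e)

variable {β : ℝ} {η ζ : Fin (emax + 1) → ℝ}

theorem midPolicy_mul (hβ : β ∈ Ioo (0 : ℝ) 1) (hη : η ∈ admissible emax)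
    (hζ : ζ ∈ admissible emax) (e : Fin (emax + 1)) :
    (steadyState β η e + steadyState β ζ e) * midPolicy β η ζ e =
      steadyState β η e * η e + steadyState β ζ e * ζ e :=
  mul_div_cancel₀ _ (add_pos (steadyState_pos hβ hη e) (steadyState_pos hβ hζ e)).ne'

theorem midPolicy_mem (hβ : β ∈ Ioo (0 : ℝ) 1) (hη : η ∈ admissible emax)
    (hζ : ζ ∈ admissible emax) : midPolicy β η ζ ∈ admissible emax := by
  -- At each level the new value is a convex combination of the two old ones, and every
  -- admissibility constraint is membership in a convex set.
  have hconv : ∀ e, ∀ s : Set ℝ, Convex ℝ s → η e ∈ s → ζ e ∈ s → midPolicy β η ζ e ∈ s := by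
    intro e s hs h1 h2
    have h3 := steadyState_pos hβ hη e
    have h4 := steadyState_pos hβ hζ e
    have h5 := convex_iff_div.1 hs h1 h2 h3.le h4.le (add_pos h3 h4)
    convert h5 using 1
    simp only [midPolicy, smul_eq_mul]
    ring
  exact ⟨hconv 0 {0} (convex_singleton 0) hη.1 hζ.1,
    hconv _ _ (convex_Ioc 0 1) hη.2.1 hζ.2.1,
    fun e h0 h1 => hconv e _ (convex_Ioo 0 1) (hη.2.2 e h0 h1) (hζ.2.2 e h0 h1)⟩

/-- Cut balance involves only `p e` and `p e * η e`, and linearly. `midPolicy` is chosen so that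
both are averaged; uniqueness of the stationary distribution then identifies the average. -/
theorem steadyState_midPolicy (hβ : β ∈ Ioo (0 : ℝ) 1) (hη : η ∈ admissible emax)
    (hζ : ζ ∈ admissible emax) (e : Fin (emax + 1)) :
    steadyState β (midPolicy β η ζ) e = (steadyState β η e + steadyState β ζ e) / 2 := by
  have hm := midPolicy_mem hβ hη hζ
  obtain ⟨hp0, hp1, hp2⟩ := steadyState_isStationary hβ hη
  obtain ⟨hq0, hq1, hq2⟩ := steadyState_isStationary hβ hζ
  have h : IsStationary β (midPolicy β η ζ)
      fun e => (steadyState β η e + steadyState β ζ e) / 2 := by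
    refine ⟨fun e => ?_, ?_, ?_⟩
    · linarith [hp0 e, hq0 e]
    · rw [← Finset.sum_div, Finset.sum_add_distrib, hp1, hq1]
      norm_num
    · rw [stationary_iff_balance β _ _ hm.1]
      intro i
      have h1 := (stationary_iff_balance β η _ hη.1).1 hp2 i
      have h2 := (stationary_iff_balance β ζ _ hζ.1).1 hq2 i
      have h3 := midPolicy_mul hβ hη hζ i.castSucc
      have h4 := midPolicy_mul hβ hη hζ i.succ
      linear_combination (1 / 2) * h1 + (1 / 2) * h2 - (β / 2) * h3 - ((1 - β) / 2) * h4
  rw [(isStationary_iff hβ hm _).1 (steadyState_isStationary hβ hm),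
    ← (isStationary_iff hβ hm _).1 h]

theorem P_midPolicy (hβ : β ∈ Ioo (0 : ℝ) 1) (hη : η ∈ admissible emax)
    (hζ : ζ ∈ admissible emax) : 2 * P β (midPolicy β η ζ) = P β η + P β ζ := by
  unfold P
  rw [Finset.mul_sum, ← Finset.sum_add_distrib]
  refine Finset.sum_congr rfl fun i _ => ?_
  rw [steadyState_midPolicy hβ hη hζ, ← midPolicy_mul hβ hη hζ]
  ring

variable {Ω : Type*} [MeasurableSpace Ω] {μ : Measure Ω}

theorem G_nonneg (M : PacketModel μ) (hβ : β ∈ Ioo (0 : ℝ) 1) (hη : η ∈ admissible emax) :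
    0 ≤ G M β η :=
  Finset.sum_nonneg fun _ _ => mul_nonneg (steadyState_pos hβ hη _).le (M.g_nonneg _)

/-- Level by level this is Jensen's inequality with weights `π_η(e)` and `π_ζ(e)`, read off from the
supporting line of `g` at the mid policy's value. It is strict at any level where the two policies
differ, because then at least one of them differs from the touching point. -/
theorem G_add_lt_midPolicy [IsProbabilityMeasure μ] (M : PacketModel μ) (hM : M.RegularUtility)
    (hβ : β ∈ Ioo (0 : ℝ) 1) (hη : η ∈ admissible emax) (hζ : ζ ∈ admissible emax)
    (hne : η ≠ ζ) : G M β η + G M β ζ < 2 * G M β (midPolicy β η ζ) := by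
  have hm := midPolicy_mem hβ hη hζ
  have hterm : ∀ i : Fin emax,
      steadyState β η i.succ * M.g (η i.succ) + steadyState β ζ i.succ * M.g (ζ i.succ) ≤
        2 * (steadyState β (midPolicy β η ζ) i.succ * M.g (midPolicy β η ζ i.succ)) ∧
      (η i.succ ≠ ζ i.succ →
        steadyState β η i.succ * M.g (η i.succ) + steadyState β ζ i.succ * M.g (ζ i.succ) <
          2 * (steadyState β (midPolicy β η ζ) i.succ * M.g (midPolicy β η ζ i.succ))) := by
    intro i
    have hp := steadyState_pos hβ hη i.succ
    have hq := steadyState_pos hβ hζ i.succ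
    have hmul := midPolicy_mul hβ hη hζ i.succ
    obtain ⟨c, hc⟩ := M.exists_strict_supergradient hM
      ⟨admissible_pos hm i, admissible_le_one hm i⟩
    have h1 := hc _ ⟨admissible_pos hη i, admissible_le_one hη i⟩
    have h2 := hc _ ⟨admissible_pos hζ i, admissible_le_one hζ i⟩
    rw [steadyState_midPolicy hβ hη hζ]
    generalize steadyState β η i.succ = p at *
    generalize steadyState β ζ i.succ = q at *
    generalize midPolicy β η ζ i.succ = z at *
    generalize η i.succ = x at *
    generalize ζ i.succ = y at *
    have h1' : M.g x ≤ M.g z + c * (x - z) := by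
      by_cases h : x = z
      · simp [h]
      · exact (h1 h).le
    have h2' : M.g y ≤ M.g z + c * (y - z) := by
      by_cases h : y = z
      · simp [h]
      · exact (h2 h).le
    -- The slope terms cancel because `z` is the weighted mean of `x` and `y`.
    have hsum : p * (M.g z + c * (x - z)) + q * (M.g z + c * (y - z)) =
        2 * ((p + q) / 2 * M.g z) := by linear_combination (-c) * hmul
    rw [← hsum]
    refine ⟨add_le_add (mul_le_mul_of_nonneg_left h1' hp.le)
      (mul_le_mul_of_nonneg_left h2' hq.le), fun hxy => ?_⟩
    by_cases h : x = z
    · exact add_lt_add_of_le_of_lt (mul_le_mul_of_nonneg_left h1' hp.le)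
        (mul_lt_mul_of_pos_left (h2 fun h' => hxy (h.trans h'.symm)) hq)
    · exact add_lt_add_of_lt_of_le (mul_lt_mul_of_pos_left (h1 h) hp)
        (mul_le_mul_of_nonneg_left h2' hq.le)
  obtain ⟨i, hi⟩ : ∃ i : Fin emax, η i.succ ≠ ζ i.succ := by
    by_contra! h
    refine hne (funext fun e => ?_)
    induction e using Fin.cases with
    | zero => rw [hη.1, hζ.1]
    | succ i => exact h i
  unfold G
  rw [Finset.mul_sum, ← Finset.sum_add_distrib]
  exact Finset.sum_lt_sum (fun i _ => (hterm i).1) ⟨i, Finset.mem_univ i, (hterm i).2 hi⟩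

/-- A maximizer of `G - L * P` over the admissible policies is unique. -/
theorem lagrangian_lt_of_isMax [IsProbabilityMeasure μ] (M : PacketModel μ)
    (hM : M.RegularUtility) (hβ : β ∈ Ioo (0 : ℝ) 1) {L : ℝ} (hζ : ζ ∈ admissible emax)
    (hmax : ∀ η ∈ admissible emax, G M β η - L * P β η ≤ G M β ζ - L * P β ζ)
    (hη : η ∈ admissible emax) (hne : η ≠ ζ) :
    G M β η - L * P β η < G M β ζ - L * P β ζ := by
  -- The average of the two Lagrangian values is strictly below the value at the mid policy, which
  -- is at most the maximum.
  have h1 := G_add_lt_midPolicy M hM hβ hη hζ hne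
  have h2 := P_midPolicy hβ hη hζ
  have h3 := hmax _ (midPolicy_mem hβ hη hζ)
  linear_combination h1 + 2 * h3 + L * h2

end Battery

/-! ### From the Lagrangian to the symmetric utility. -/

/-- The induction rests on `(1 + (n + 1) t) (1 - t) = 1 + n t - (n + 1) t ^ 2 ≤ 1 + n t`. -/
theorem one_add_mul_mul_one_sub_pow_le {t : ℝ} (ht : t ≤ 1) (n : ℕ) :
    (1 + n * t) * (1 - t) ^ n ≤ 1 := by
  induction n with
  | zero => simp
  | succ n ih =>
    refine le_trans ?_ ih
    rw [pow_succ', ← mul_assoc]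
    refine mul_le_mul_of_nonneg_right ?_ (pow_nonneg (by linarith) n)
    push_cast
    have : 0 ≤ ((n : ℝ) + 1) * t ^ 2 := by positivity
    linarith

/-- A symmetric Nash equilibrium is the strict global maximizer of the symmetric utility. -/
theorem symUtility_lt_of_isSNE {Ω : Type*} [MeasurableSpace Ω] {μ : Measure Ω}
    [IsProbabilityMeasure μ] (M : PacketModel μ) (hM : M.RegularUtility) {β : ℝ}
    (hβ : β ∈ Ioo (0 : ℝ) 1) {U emax : ℕ} (hU : 1 ≤ U) {ηstar η : Fin (emax + 1) → ℝ}
    (hstar : IsSNE U M β ηstar) (hη : η ∈ admissible emax) (hne : η ≠ ηstar) :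
    symUtility U M β η < symUtility U M β ηstar := by
  obtain ⟨hs, hmax⟩ := (isSNE_iff hU M hβ ηstar).1 hstar
  have hlt := lagrangian_lt_of_isMax M hM hβ hs hmax hη hne
  obtain ⟨n, rfl⟩ : ∃ n, U = n + 1 := ⟨U - 1, by omega⟩
  have hG := G_nonneg M hβ hs
  have hq : 0 < 1 - P β ηstar := by linarith [P_lt_one hβ hs]
  have hr : 0 < 1 - P β η := by linarith [P_lt_one hβ hη]
  -- The relative drop in idle probability: it turns `Λ(η*) (P(η) - P(η*))` into `n t G(η*)`.
  set t := (P β η - P β ηstar) / (1 - P β ηstar) with ht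
  have hrt : 1 - P β η = (1 - P β ηstar) * (1 - t) := by
    rw [ht]; field_simp; ring
  have ht1 : 0 < 1 - t := pos_of_mul_pos_right (hrt ▸ hr) hq.le
  have hGlt : G M β η < G M β ηstar * (1 + n * t) := by
    have : G M β ηstar * (1 + n * t) =
        G M β ηstar + Lam (n + 1) M β ηstar * (P β η - P β ηstar) := by
      rw [ht, Lam]; push_cast; field_simp; ring
    rw [this]
    linarith
  have hU' : (0 : ℝ) < ((n + 1 : ℕ) : ℝ) := by positivity
  rw [symUtility, symUtility, Nat.add_sub_cancel, mul_assoc, mul_assoc]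
  refine mul_lt_mul_of_pos_left ?_ hU'
  calc G M β η * (1 - P β η) ^ n
      < G M β ηstar * (1 + n * t) * (1 - P β η) ^ n := mul_lt_mul_of_pos_right hGlt (pow_pos hr n)
    _ = G M β ηstar * (1 - P β ηstar) ^ n * ((1 + n * t) * (1 - t) ^ n) := by
        rw [hrt, mul_pow]; ring
    _ ≤ G M β ηstar * (1 - P β ηstar) ^ n * 1 :=
        mul_le_mul_of_nonneg_left (one_add_mul_mul_one_sub_pow_le (by linarith) n)
          (mul_nonneg hG (pow_nonneg hq.le n))
    _ = G M β ηstar * (1 - P β ηstar) ^ n := mul_one _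

end EHNetwork

theorem theorem3 {Ω : Type*} [MeasurableSpace Ω] (μ : MeasureTheory.Measure Ω)
    [MeasureTheory.IsProbabilityMeasure μ] (M : EHNetwork.PacketModel μ) (hM : M.RegularUtility)
    (β : ℝ) (hβ : β ∈ Set.Ioo (0 : ℝ) 1) (U emax : ℕ) (hU : 1 ≤ U) (hemax : 1 ≤ emax)
    (ηstar : Fin (emax + 1) → ℝ) (hη : EHNetwork.IsSNE U M β ηstar) :
    ∃ ε > 0, ∀ η ∈ EHNetwork.admissible emax, η ≠ ηstar → dist η ηstar < ε →
      EHNetwork.symUtility U M β η < EHNetwork.symUtility U M β ηstar := by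
  -- The radius is arbitrary, since the strict inequality holds on all of the admissible set.
  exact ⟨1, one_pos, fun η hη' hne _ =>
    EHNetwork.symUtility_lt_of_isSNE M hM hβ hU hη hη' hne⟩
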